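/- For an integer $N\ge 0$ let $h=1/(N+1)$ and $x_s=sh$ for $s\in\frac12\mathbb Z$. For $\delta>0$ let $$\mathcal L_\delta u(x)=\int_{|y-x|<\delta}[u(y)-u(x)]\,\frac{3}{\delta^3}\,dy .$$ Let $r=\lfloor \delta/h\rfloor$ if $\delta\ge h$ and $r=\lceil\delta/h\rceil=1$ if $\delta<h$, and put $\widetilde\delta=rh$. Call $\delta$ a grid point if $\delta=kh$ for some integer $k$ (equivalently, if $\delta=\widetilde\delta$). The shifted-symmetric collocation operator is, at $x_{i/2}$ with $1\le i\le 2N+1$, $$\mathcal L^S_{\widetilde\delta,h}u(x_{i/2})=\frac{h}{2\widetilde\delta^{3}}\Big[\sum_{m=-r}^{r}a_{|m|}\,u(x_{i/2+m})+\sum_{m=-r}^{r-1}a_{|m+1/2|}\,u(x_{i/2+m+1/2})\Big],$$ where $a_0=2-12r$, $a_m=2$ for $1\le m\le r-1$, $a_r=1$, and $a_{m+1/2}=4$ for $0\le m\le r-1$. **Theorem (local truncation error of the shifted-symmetric scheme).** Let $\beta\ge 0$, $c_1>0$, and let $c_2,M$ be real. There is a constant $C$, depending only on $\beta,c_1,c_2,M$,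 such that the following holds for all integers $N\ge0$, all $\delta>0$ with $\delta\le c_2h^\beta$ (that is, $\delta=\mathcal O(h^\beta)$), all $u$ of class $C^4$ on $[-\rho,1+\rho]$, $\rho=\max\{\delta,\widetilde\delta\}$, with $|u^{(4)}|\le M$ there, and all $1\le i\le 2N+1$: 1. if $\delta$ is not a grid point, then $$\big|\mathcal L_\delta u(x_{i/2})-\mathcal L^S_{\widetilde\delta,h}u(x_{i/2})\big|\le C\,h^{\min\{2,\,1+\beta\}};$$ 2. if $\delta$ is a grid point and $\delta$ is of exact order $h^\beta$, that is, also $\delta\ge c_1h^\beta$, then $$\big|\mathcal L_\delta u(x_{i/2})-\mathcal L^S_{\widetilde\delta,h}u(x_{i/2})\big|\le C\,h^{\max\{2,\,4-2\beta\}}.$$ -/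

import Mathlib

open MeasureTheory

noncomputable section

namespace NonlocalCollocation

/-- Mesh size `h = 1/(N+1)`. -/
def meshSize (N : ℕ) : ℝ := 1 / ((N : ℝ) + 1)

/-- The (half-)mesh points, indexed by twice their index: `node N k` is `x_{k/2} = (k/2) h`. -/
def node (N : ℕ) (k : ℤ) : ℝ := ((k : ℝ) / 2) * meshSize N

/-- The constant interaction kernel `γ_δ(z) = 3/δ³`, as a function of the distance `z`. -/
def kernel (δ : ℝ) (_z : ℝ) : ℝ := 3 / δ ^ 3

/-- The nonlocal operator `L_δ u(x) = ∫_{B_δ(x)} [u(y) - u(x)] γ_δ(|y - x|) dy`. -/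
def nonlocalOp (δ : ℝ) (u : ℝ → ℝ) (x : ℝ) : ℝ :=
  ∫ y in Metric.ball x δ, (u y - u x) * kernel δ |y - x|

/-- The ratio `r`: it is `⌊δ/h⌋` if `δ ≥ h`, and `⌈δ/h⌉` (that is, `1`) if `0 < δ < h`. -/
def ratio (N : ℕ) (δ : ℝ) : ℕ :=
  if meshSize N ≤ δ then ⌊δ / meshSize N⌋₊ else ⌈δ / meshSize N⌉₊

/-- The discrete horizon `δ̃ = r h`. -/
def discreteHorizon (N : ℕ) (δ : ℝ) : ℝ := (ratio N δ : ℝ) * meshSize N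

/-- `δ` is a grid point: `δ = k h` for some natural number `k`
(mesh points are the integer multiples of `h`). -/
def IsGridPoint (N : ℕ) (δ : ℝ) : Prop := ∃ k : ℕ, δ = (k : ℝ) * meshSize N

/-- The coefficients `a_{|m|}` with integer index:
`a_0 = 2 - 12 r`, `a_m = 2` for `1 ≤ m ≤ r - 1`, `a_r = 1`. -/
def coeffInt (r : ℕ) (m : ℤ) : ℝ :=
  if m = 0 then 2 - 12 * (r : ℝ) else if m.natAbs < r then 2 else 1

/-- The coefficients `a_{|m + 1/2|}` with half-integer index, all equal to `4`. -/
def coeffHalf (_m : ℤ) : ℝ := 4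

/-- The shifted-symmetric collocation operator at the point `x_{k/2}`:
`L^S u(x_{k/2}) = h/(2 δ̃³) [∑_{m=-r}^{r} a_{|m|} u(x_{k/2+m}) +
  ∑_{m=-r}^{r-1} a_{|m+1/2|} u(x_{k/2+m+1/2})]`.
Even `k` gives the integer points `x_i`, odd `k` the midpoints `x_{i+1/2}`. -/
def shiftedSymmetricOp (N : ℕ) (δ : ℝ) (u : ℝ → ℝ) (k : ℤ) : ℝ :=
  meshSize N / (2 * discreteHorizon N δ ^ 3) *
    (∑ m ∈ Finset.Icc (-(ratio N δ : ℤ)) (ratio N δ : ℤ),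
        coeffInt (ratio N δ) m * u (node N (k + 2 * m)) +
      ∑ m ∈ Finset.Ico (-(ratio N δ : ℤ)) (ratio N δ : ℤ),
        coeffHalf m * u (node N (k + 2 * m + 1)))

/-- The closed interval `[-ρ, 1 + ρ]`, `ρ = max δ δ̃`, on which both operators look at `u`. If
`δ ≥ h` it is the closed domain `[0, 1]` together with the volumetric constraint domain
`[-δ, 0] ∪ [1, 1 + δ]`. -/
def enlargedDomain (N : ℕ) (δ : ℝ) : Set ℝ :=
  Set.Icc (-max δ (discreteHorizon N δ)) (1 + max δ (discreteHorizon N δ))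

end NonlocalCollocation

end

namespace NonlocalCollocation

open intervalIntegral

/-! The shifted-symmetric operator is the nonlocal operator of horizon `δ̃ = r h` with its integral
replaced by composite Simpson on `2r` cells of width `h` (`shiftedSymmetricOp_eq`). Simpson's rule
is exact on cubics, so each cell costs `O(h⁵)`; with the factor `3/δ̃³` the quadrature error is
`O(h⁴/δ̃²)` (`abs_nonlocalOp_discreteHorizon_sub_le`).

At a grid point `δ̃ = δ` and this is the whole error. Otherwise the horizon must also be changed
from `δ` to `δ̃`. The kernel is normalised so that a cubic with quadratic coefficient `c` at `x` is
sent to `2c` for every horizon, hence only the quartic remainder feels the change: `O(hδ)` if `δ ≥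
h`, `O(h²)` if `δ < h`. -/

/-- `u` is approximated around each point of `s` by a cubic polynomial, uniformly to fourth order. -/
def HasCubicApprox (u : ℝ → ℝ) (s : Set ℝ) (M : ℝ) : Prop :=
  ∀ x ∈ s, ∃ b c d : ℝ, ∀ y ∈ s,
    |u y - (u x + b * (y - x) + c * (y - x) ^ 2 + d * (y - x) ^ 3)| ≤ M * |y - x| ^ 4

/-- Mean value inequality on the segment from `x` to `y`. It forgoes the factor `1/(n+1)` that
integration would give, so four uses yield the constant `M` instead of `M/24`. -/
theorem abs_le_pow_succ_of_hasDerivWithinAt {g g' : ℝ → ℝ} {s : Set ℝ} {x K : ℝ} {n : ℕ}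
    (hs : Convex ℝ s) (hK : 0 ≤ K) (hx : x ∈ s)
    (hg : ∀ y ∈ s, HasDerivWithinAt g (g' y) s y) (hgx : g x = 0)
    (hb : ∀ y ∈ s, |g' y| ≤ K * |y - x| ^ n) :
    ∀ y ∈ s, |g y| ≤ K * |y - x| ^ (n + 1) := by
  intro y hy
  have hsub : Set.uIcc x y ⊆ s := by
    rw [← segment_eq_uIcc]; exact hs.segment_subset hx hy
  have key := (convex_uIcc x y).norm_image_sub_le_of_norm_hasDerivWithin_le
    (f := g) (f' := g') (C := K * |y - x| ^ n) (x := x) (y := y)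
    (fun z hz => (hg z (hsub hz)).mono hsub)
    (fun z hz => (hb z (hsub hz)).trans (by
      have : |z - x| ≤ |y - x| := Set.abs_sub_left_of_mem_uIcc hz
      gcongr))
    Set.left_mem_uIcc Set.right_mem_uIcc
  rw [hgx, sub_zero, Real.norm_eq_abs, Real.norm_eq_abs] at key
  rw [pow_succ, ← mul_assoc]
  exact key

theorem hasCubicApprox_of_contDiffOn {u : ℝ → ℝ} {A B M : ℝ} (hAB : A < B)
    (hu : ContDiffOn ℝ 4 u (Set.Icc A B))
    (hM : ∀ x ∈ Set.Icc A B, |iteratedDerivWithin 4 u (Set.Icc A B) x| ≤ M) :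
    HasCubicApprox u (Set.Icc A B) M := by
  intro x hx
  set s := Set.Icc A B with hsdef
  have hM0 : 0 ≤ M := (abs_nonneg _).trans (hM x hx)
  have hs : Convex ℝ s := convex_Icc A B
  have hud : UniqueDiffOn ℝ s := uniqueDiffOn_Icc hAB
  let U : ℕ → ℝ → ℝ := fun k => iteratedDerivWithin k u s
  have hU : ∀ k : ℕ, k < 4 → ∀ y ∈ s, HasDerivWithinAt (U k) (U (k + 1) y) s y := by
    intro k hk y hy
    have h1 : DifferentiableWithinAt ℝ (U k) s y :=
      (hu.differentiableOn_iteratedDerivWithin (by exact_mod_cast hk) hud) y hy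
    have h2 := h1.hasDerivWithinAt
    rwa [← iteratedDerivWithin_succ] at h2
  have hU0 : U 0 = u := by ext y; simp [U]
  have hid : ∀ y, HasDerivWithinAt (fun y : ℝ => y - x) 1 s y := fun y =>
    (hasDerivWithinAt_id y s).sub_const x
  have h3 := abs_le_pow_succ_of_hasDerivWithinAt (g := fun y => U 3 y - U 3 x)
    (g' := U 4) (n := 0) hs hM0 hx
    (fun y hy => (hU 3 (by norm_num) y hy).sub_const _) (by simp)
    (fun y hy => by simpa using hM y hy)
  have h2 := abs_le_pow_succ_of_hasDerivWithinAt
    (g := fun y => U 2 y - (U 2 x + U 3 x * (y - x)))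
    (g' := fun y => U 3 y - U 3 x) hs hM0 hx
    (fun y hy => by
      refine ((hU 2 (by norm_num) y hy).sub (((hid y).const_mul (U 3 x)).const_add _)).congr_deriv ?_
      ring) (by simp) h3
  have h1 := abs_le_pow_succ_of_hasDerivWithinAt
    (g := fun y => U 1 y - (U 1 x + U 2 x * (y - x) + U 3 x / 2 * (y - x) ^ 2))
    (g' := fun y => U 2 y - (U 2 x + U 3 x * (y - x))) hs hM0 hx
    (fun y hy => by
      refine ((hU 1 (by norm_num) y hy).sub ((((hid y).const_mul (U 2 x)).const_add _).add
        (((hid y).pow 2).const_mul (U 3 x / 2)))).congr_deriv ?_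
      push_cast; ring) (by simp) h2
  have h0 := abs_le_pow_succ_of_hasDerivWithinAt
    (g := fun y => U 0 y -
      (U 0 x + U 1 x * (y - x) + U 2 x / 2 * (y - x) ^ 2 + U 3 x / 6 * (y - x) ^ 3))
    (g' := fun y => U 1 y - (U 1 x + U 2 x * (y - x) + U 3 x / 2 * (y - x) ^ 2)) hs hM0 hx
    (fun y hy => by
      refine ((hU 0 (by norm_num) y hy).sub (((((hid y).const_mul (U 1 x)).const_add _).add
        (((hid y).pow 2).const_mul (U 2 x / 2))).add
        (((hid y).pow 3).const_mul (U 3 x / 6)))).congr_deriv ?_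
      push_cast; ring) (by simp) h1
  rw [hU0] at h0
  exact ⟨U 1 x, U 2 x / 2, U 3 x / 6, h0⟩

/-! ### Simpson's rule and its composite error -/

theorem integral_cubic (x a b c d s t : ℝ) :
    ∫ y in s..t, (a + b * (y - x) + c * (y - x) ^ 2 + d * (y - x) ^ 3) =
      (a * (t - x) + b / 2 * (t - x) ^ 2 + c / 3 * (t - x) ^ 3 + d / 4 * (t - x) ^ 4) -
      (a * (s - x) + b / 2 * (s - x) ^ 2 + c / 3 * (s - x) ^ 3 + d / 4 * (s - x) ^ 4) := by
  refine integral_eq_sub_of_hasDerivAt (f := fun y => a * (y - x) + b / 2 * (y - x) ^ 2 +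
    c / 3 * (y - x) ^ 3 + d / 4 * (y - x) ^ 4) (fun y _ => ?_)
    (Continuous.intervalIntegrable (by fun_prop) _ _)
  have hid : HasDerivAt (fun y : ℝ => y - x) 1 y := (hasDerivAt_id y).sub_const x
  refine ((((hid.const_mul a).add ((hid.pow 2).const_mul (b / 2))).add
    ((hid.pow 3).const_mul (c / 3))).add ((hid.pow 4).const_mul (d / 4))).congr_deriv ?_
  push_cast; ring

/-- Simpson's rule on `[a, a + h]`. -/
noncomputable def simpson (u : ℝ → ℝ) (h a : ℝ) : ℝ :=
  h / 6 * (u a + 4 * u (a + h / 2) + u (a + h))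

theorem abs_integral_sub_simpson_le {u : ℝ → ℝ} {s : Set ℝ} {M a h : ℝ}
    (hu : ContinuousOn u s) (hT : HasCubicApprox u s M) (hM : 0 ≤ M) (hh : 0 ≤ h)
    (hs : Set.Icc a (a + h) ⊆ s) :
    |(∫ y in a..(a + h), u y) - simpson u h a| ≤ 2 * M * h ^ 5 := by
  have hle : a ≤ a + h := by linarith
  obtain ⟨b, c, d, hp⟩ := hT a (hs (Set.left_mem_Icc.2 hle))
  set p : ℝ → ℝ := fun y => u a + b * (y - a) + c * (y - a) ^ 2 + d * (y - a) ^ 3 with hpdef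
  have hpc : Continuous p := by fun_prop
  have hui : IntervalIntegrable u volume a (a + h) :=
    (hu.mono (by rwa [Set.uIcc_of_le hle])).intervalIntegrable
  -- Exactness on cubics leaves two errors, the integral of `u - p` and its Simpson sum, each at
  -- most `M h⁵`.
  have hsimp : (∫ y in a..(a + h), p y) = simpson p h a := by
    rw [hpdef, integral_cubic, simpson]; ring
  have hb : ∀ y ∈ Set.Icc a (a + h), |u y - p y| ≤ M * h ^ 4 := fun y hy =>
    (hp y (hs hy)).trans (by
      have : |y - a| ≤ h := by rw [abs_le]; constructor <;> linarith [hy.1, hy.2]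
      gcongr)
  have h1 : |∫ y in a..(a + h), (u y - p y)| ≤ M * h ^ 4 * h := by
    have := norm_integral_le_of_norm_le_const (a := a) (b := a + h)
      (f := fun y => u y - p y) (C := M * h ^ 4) (fun y hy => by
        rw [Set.uIoc_of_le hle] at hy
        exact hb y ⟨hy.1.le, hy.2⟩)
    rwa [Real.norm_eq_abs, add_sub_cancel_left, abs_of_nonneg hh] at this
  rw [integral_sub hui (hpc.intervalIntegrable _ _), hsimp] at h1
  have e0 := abs_le.1 (hb a ⟨le_rfl, hle⟩)
  have e1 := abs_le.1 (hb (a + h / 2) ⟨by linarith, by linarith⟩)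
  have e2 := abs_le.1 (hb (a + h) ⟨hle, le_rfl⟩)
  have h2 : |simpson p h a - simpson u h a| ≤ M * h ^ 4 * h := by
    have : simpson p h a - simpson u h a = h / 6 * -((u a - p a) +
      4 * (u (a + h / 2) - p (a + h / 2)) + (u (a + h) - p (a + h))) := by
      simp only [simpson]; ring
    rw [this, abs_mul, abs_of_nonneg (by positivity)]
    have h6 : |-((u a - p a) + 4 * (u (a + h / 2) - p (a + h / 2)) + (u (a + h) - p (a + h)))|
      ≤ 6 * (M * h ^ 4) := by rw [abs_le]; constructor <;> linarith
    calc _ ≤ h / 6 * (6 * (M * h ^ 4)) := by gcongr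
      _ = _ := by ring
  have h3 := abs_sub_le (∫ y in a..(a + h), u y) (simpson p h a) (simpson u h a)
  linarith

theorem abs_integral_sub_sum_simpson_le {u : ℝ → ℝ} {s : Set ℝ} {M a h : ℝ}
    (hu : ContinuousOn u s) (hT : HasCubicApprox u s M) (hM : 0 ≤ M) (hh : 0 ≤ h) (n : ℕ)
    (hs : Set.Icc a (a + n * h) ⊆ s) :
    |(∫ y in a..(a + n * h), u y) - ∑ j ∈ Finset.range n, simpson u h (a + j * h)| ≤
      n * (2 * M * h ^ 5) := by
  induction n with
  | zero => simp
  | succ n ih =>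
    have hn : 0 ≤ (n : ℝ) * h := by positivity
    have e : a + ((n + 1 : ℕ) : ℝ) * h = a + n * h + h := by push_cast; ring
    rw [e] at hs ⊢
    have hs1 : Set.Icc a (a + n * h) ⊆ s := (Set.Icc_subset_Icc_right (by linarith)).trans hs
    have hs2 : Set.Icc (a + n * h) (a + n * h + h) ⊆ s :=
      (Set.Icc_subset_Icc_left (by linarith)).trans hs
    have i1 : IntervalIntegrable u volume a (a + n * h) :=
      (hu.mono (by rwa [Set.uIcc_of_le (by linarith)])).intervalIntegrable
    have i2 : IntervalIntegrable u volume (a + n * h) (a + n * h + h) :=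
      (hu.mono (by rwa [Set.uIcc_of_le (by linarith)])).intervalIntegrable
    rw [← integral_add_adjacent_intervals i1 i2, Finset.sum_range_succ, add_sub_add_comm]
    refine (abs_add_le _ _).trans ?_
    have := ih hs1
    have := abs_integral_sub_simpson_le hu hT hM hh hs2
    push_cast
    linarith

/-! ### Integral form of the operator and regrouping of the stencil -/

theorem nonlocalOp_eq {δ : ℝ} (hδ : 0 < δ) (u : ℝ → ℝ) (x : ℝ) :
    nonlocalOp δ u x = 3 / δ ^ 3 * ∫ y in (x - δ)..(x + δ), (u y - u x) := by
  rw [nonlocalOp, Real.ball_eq_Ioo, integral_of_le (by linarith), integral_Ioc_eq_integral_Ioo]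
  simp only [kernel]
  rw [MeasureTheory.integral_mul_const, mul_comm]

/-- Each unit cell gives weight 1 to both its ends: inner nodes are shared by two cells, the extreme
ones belong to one. The `-12 r` at `0` is split off. -/
theorem sum_coeffInt_mul {r : ℕ} (hr : 1 ≤ r) (v : ℤ → ℝ) :
    ∑ m ∈ Finset.Icc (-(r : ℤ)) r, coeffInt r m * v m =
      ∑ m ∈ Finset.Ico (-(r : ℤ)) r, (v m + v (m + 1)) - 12 * r * v 0 := by
  have hc : ∀ m ∈ Finset.Icc (-(r : ℤ)) r, coeffInt r m * v m =
      (v m + v m) - (if m = 0 then 12 * r * v m else 0) - (if m = r then v m else 0) -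
        (if m = -(r : ℤ) then v m else 0) := by
    intro m hm
    rw [Finset.mem_Icc] at hm
    unfold coeffInt
    split_ifs <;> first | omega | ring
  have h1 : ∑ m ∈ Finset.Icc (-(r : ℤ)) r, v m = ∑ m ∈ Finset.Ico (-(r : ℤ)) r, v m + v r := by
    rw [← Finset.Ico_insert_right (by omega : -(r : ℤ) ≤ r), Finset.sum_insert (by simp), add_comm]
  have h2 : ∑ m ∈ Finset.Icc (-(r : ℤ)) r, v m =
      ∑ m ∈ Finset.Ico (-(r : ℤ)) r, v (m + 1) + v (-r) := by
    rw [← Finset.Ioc_insert_left (by omega : -(r : ℤ) ≤ r), Finset.sum_insert (by simp), add_comm]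
    congr 1
    refine Finset.sum_bij' (fun m _ => m - 1) (fun m _ => m + 1) ?_ ?_ ?_ ?_ ?_ <;>
      intro m hm <;> simp at hm ⊢ <;> omega
  rw [Finset.sum_congr rfl hc]
  simp only [Finset.sum_sub_distrib, Finset.sum_add_distrib, Finset.sum_ite_eq', Finset.mem_Icc]
  rw [if_pos (by omega), if_pos (by omega), if_pos (by omega)]
  linarith

theorem sum_Ico_neg_eq_sum_range (r : ℕ) (f : ℤ → ℝ) :
    ∑ m ∈ Finset.Ico (-(r : ℤ)) r, f m = ∑ j ∈ Finset.range (2 * r), f ((j : ℤ) - r) := by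
  refine Finset.sum_bij' (fun m _ => (m + r).toNat) (fun j _ => (j : ℤ) - r) ?_ ?_ ?_ ?_ ?_
  · intro m hm; simp at hm ⊢; omega
  · intro m hm; simp at hm ⊢; omega
  · intro m hm; simp at hm ⊢; omega
  · intro m hm; simp
  · intro m hm
    simp at hm
    congr 1
    omega

/-! ### The mesh and the discrete horizon -/

theorem meshSize_pos (N : ℕ) : 0 < meshSize N := by unfold meshSize; positivity

theorem meshSize_le_one (N : ℕ) : meshSize N ≤ 1 := by
  unfold meshSize
  rw [div_le_one (by positivity)]
  linarith [(Nat.cast_nonneg N : (0 : ℝ) ≤ N)]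

theorem one_le_ratio {N : ℕ} {δ : ℝ} (hδ : 0 < δ) : 1 ≤ ratio N δ := by
  have hh := meshSize_pos N
  unfold ratio
  split_ifs with h
  · rw [Nat.one_le_floor_iff, one_le_div hh]; exact h
  · exact Nat.one_le_ceil_iff.2 (by positivity)

theorem discreteHorizon_of_lt {N : ℕ} {δ : ℝ} (hδ : 0 < δ) (h : δ < meshSize N) :
    discreteHorizon N δ = meshSize N := by
  have hh := meshSize_pos N
  have : ratio N δ = 1 := by
    refine le_antisymm ?_ (one_le_ratio hδ)
    rw [ratio, if_neg (not_le.2 h), Nat.ceil_le, Nat.cast_one, div_le_one hh]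
    exact h.le
  rw [discreteHorizon, this]; simp

theorem discreteHorizon_le {N : ℕ} {δ : ℝ} (h : meshSize N ≤ δ) : discreteHorizon N δ ≤ δ := by
  have hh := meshSize_pos N
  rw [discreteHorizon, ratio, if_pos h, ← le_div_iff₀ hh]
  exact Nat.floor_le (div_nonneg (hh.le.trans h) hh.le)

theorem lt_discreteHorizon_add {N : ℕ} {δ : ℝ} (h : meshSize N ≤ δ) :
    δ < discreteHorizon N δ + meshSize N := by
  have hh := meshSize_pos N
  have := Nat.lt_floor_add_one (δ / meshSize N)
  rw [div_lt_iff₀ hh] at this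
  rw [discreteHorizon, ratio, if_pos h]
  linarith

theorem meshSize_le_discreteHorizon {N : ℕ} {δ : ℝ} (hδ : 0 < δ) :
    meshSize N ≤ discreteHorizon N δ := by
  have : (1 : ℝ) ≤ ratio N δ := by exact_mod_cast one_le_ratio hδ
  exact le_mul_of_one_le_left (meshSize_pos N).le this

theorem IsGridPoint.meshSize_le {N : ℕ} {δ : ℝ} (hδ : 0 < δ) (hg : IsGridPoint N δ) :
    meshSize N ≤ δ := by
  obtain ⟨k, hk⟩ := hg
  have hk0 : k ≠ 0 := by rintro rfl; simp at hk; linarith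
  have : (1 : ℝ) ≤ k := by exact_mod_cast Nat.one_le_iff_ne_zero.2 hk0
  rw [hk]
  exact le_mul_of_one_le_left (meshSize_pos N).le this

theorem IsGridPoint.discreteHorizon_eq {N : ℕ} {δ : ℝ} (hδ : 0 < δ) (hg : IsGridPoint N δ) :
    discreteHorizon N δ = δ := by
  have hle := hg.meshSize_le hδ
  obtain ⟨k, hk⟩ := hg
  have : δ / meshSize N = k := by rw [hk, mul_div_cancel_right₀ _ (meshSize_pos N).ne']
  rw [discreteHorizon, ratio, if_pos hle, this, Nat.floor_natCast, ← hk]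

theorem node_mem_Icc {N i : ℕ} (hi : i ≤ 2 * N + 1) : node N i ∈ Set.Icc (0 : ℝ) 1 := by
  have hi' : (i : ℝ) ≤ 2 * N + 1 := by exact_mod_cast hi
  have hN : (0 : ℝ) < N + 1 := by positivity
  unfold node meshSize
  push_cast
  refine ⟨by positivity, ?_⟩
  rw [mul_one_div, div_le_one hN]
  linarith

/-! ### Quadrature error at the discrete horizon -/

/-- The cells start at `x_{k/2} - δ̃`, so the parity of `k` plays no role. The prefactor matches
because `h/2 = 3 · h/6`, and `(h/6) · 12r = 2δ̃`. -/
theorem shiftedSymmetricOp_eq {N : ℕ} {δ : ℝ} (hδ : 0 < δ) (u : ℝ → ℝ) (k : ℤ) :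
    shiftedSymmetricOp N δ u k = 3 / discreteHorizon N δ ^ 3 *
      (∑ j ∈ Finset.range (2 * ratio N δ),
        simpson u (meshSize N) (node N k - discreteHorizon N δ + j * meshSize N) -
        2 * discreteHorizon N δ * u (node N k)) := by
  have hnode : ∀ m : ℤ, node N (k + 2 * m) = node N k + m * meshSize N := by
    intro m; simp only [node]; push_cast; ring
  have hnode' : ∀ m : ℤ, node N (k + 2 * m + 1) = node N k + m * meshSize N + meshSize N / 2 := by
    intro m; simp only [node]; push_cast; ring
  unfold shiftedSymmetricOp coeffHalf
  simp only [hnode, hnode']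
  rw [sum_coeffInt_mul (one_le_ratio hδ) (fun m : ℤ => u (node N k + m * meshSize N)),
    sub_add_eq_add_sub, ← Finset.sum_add_distrib, sum_Ico_neg_eq_sum_range]
  have hs : ∀ j : ℕ, simpson u (meshSize N)
      (node N k - discreteHorizon N δ + j * meshSize N) = meshSize N / 6 *
      (u (node N k + (((j : ℤ) - ratio N δ : ℤ) : ℝ) * meshSize N) +
        u (node N k + (((j : ℤ) - ratio N δ + 1 : ℤ) : ℝ) * meshSize N) +
        4 * u (node N k + (((j : ℤ) - ratio N δ : ℤ) : ℝ) * meshSize N + meshSize N / 2)) := by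
    intro j
    have e1 : node N k + (((j : ℤ) - ratio N δ : ℤ) : ℝ) * meshSize N =
      node N k - discreteHorizon N δ + j * meshSize N := by
      simp only [discreteHorizon]; push_cast; ring
    have e2 : node N k + (((j : ℤ) - ratio N δ + 1 : ℤ) : ℝ) * meshSize N =
      node N k - discreteHorizon N δ + j * meshSize N + meshSize N := by
      simp only [discreteHorizon]; push_cast; ring
    rw [e1, e2, simpson]; ring
  simp only [hs, ← Finset.mul_sum]
  rw [Int.cast_zero, zero_mul, add_zero]
  have hd : discreteHorizon N δ = ratio N δ * meshSize N := rfl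
  generalize (∑ j ∈ Finset.range (2 * ratio N δ), (_ : ℝ)) = S
  rw [show 2 * discreteHorizon N δ * u (node N k) =
    2 * (ratio N δ * meshSize N) * u (node N k) by rw [hd]]
  ring

theorem abs_nonlocalOp_discreteHorizon_sub_le {N : ℕ} {δ M : ℝ} {u : ℝ → ℝ} {s : Set ℝ} {k : ℤ}
    (hδ : 0 < δ) (hu : ContinuousOn u s) (hT : HasCubicApprox u s M) (hM : 0 ≤ M)
    (hs : Set.Icc (node N k - discreteHorizon N δ) (node N k + discreteHorizon N δ) ⊆ s) :
    |nonlocalOp (discreteHorizon N δ) u (node N k) - shiftedSymmetricOp N δ u k| ≤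
      12 * M * meshSize N ^ 4 / discreteHorizon N δ ^ 2 := by
  have hh := meshSize_pos N
  have hd : 0 < discreteHorizon N δ := hh.trans_le (meshSize_le_discreteHorizon hδ)
  rw [nonlocalOp_eq hd, shiftedSymmetricOp_eq hδ]
  have hrd : discreteHorizon N δ = ratio N δ * meshSize N := rfl
  set d := discreteHorizon N δ
  set x := node N k
  set h := meshSize N
  set r := ratio N δ
  have he : x - d + ((2 * r : ℕ) : ℝ) * h = x + d := by rw [hrd]; push_cast; ring
  have key := abs_integral_sub_sum_simpson_le hu hT hM hh.le (2 * r) (a := x - d) (by rwa [he])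
  rw [he] at key
  have hui : IntervalIntegrable u volume (x - d) (x + d) :=
    (hu.mono (by rwa [Set.uIcc_of_le (by linarith)])).intervalIntegrable
  rw [integral_sub hui intervalIntegrable_const, intervalIntegral.integral_const, smul_eq_mul,
    ← mul_sub, abs_mul, abs_of_nonneg (by positivity)]
  have hb : ((2 * r : ℕ) : ℝ) * (2 * M * h ^ 5) = 4 * M * h ^ 4 * d := by
    rw [hrd]; push_cast; ring
  rw [hb] at key
  have e2 : (∫ y in (x - d)..(x + d), u y) - (x + d - (x - d)) * u x -
      (∑ j ∈ Finset.range (2 * r), simpson u h (x - d + j * h) - 2 * d * u x) =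
      (∫ y in (x - d)..(x + d), u y) -
      ∑ j ∈ Finset.range (2 * r), simpson u h (x - d + j * h) := by ring
  rw [e2]
  calc _ ≤ 3 / d ^ 3 * (4 * M * h ^ 4 * d) := by gcongr
    _ = _ := by field_simp; ring

/-! ### Changing the horizon -/

/-- Around `x` the nonlocal operator is `2 c` plus the nonlocal operator of the remainder of the
cubic approximation with quadratic coefficient `c`. -/
theorem nonlocalOp_eq_add_remainder {u : ℝ → ℝ} {x b c d δ : ℝ} (hδ : 0 < δ)
    (hu : ContinuousOn u (Set.Icc (x - δ) (x + δ))) :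
    nonlocalOp δ u x = 2 * c + 3 / δ ^ 3 * ∫ y in (x - δ)..(x + δ),
      (u y - (u x + b * (y - x) + c * (y - x) ^ 2 + d * (y - x) ^ 3)) := by
  have hui : IntervalIntegrable u volume (x - δ) (x + δ) :=
    (hu.mono (by rw [Set.uIcc_of_le (by linarith)])).intervalIntegrable
  rw [nonlocalOp_eq hδ, integral_sub hui intervalIntegrable_const,
    integral_sub hui (Continuous.intervalIntegrable (by fun_prop) _ _), integral_cubic,
    intervalIntegral.integral_const, smul_eq_mul]
  field_simp
  ring

theorem abs_integral_le_of_quartic {R : ℝ → ℝ} {x s t M ρ : ℝ} (hst : s ≤ t) (hM : 0 ≤ M)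
    (hs : x - ρ ≤ s) (ht : t ≤ x + ρ) (hR : ∀ y ∈ Set.Icc s t, |R y| ≤ M * |y - x| ^ 4) :
    |∫ y in s..t, R y| ≤ M * ρ ^ 4 * (t - s) := by
  have := norm_integral_le_of_norm_le_const (a := s) (b := t) (f := R) (C := M * ρ ^ 4)
    (fun y hy => by
      rw [Set.uIoc_of_le hst] at hy
      refine (hR y ⟨hy.1.le, hy.2⟩).trans ?_
      have : |y - x| ≤ ρ := by rw [abs_le]; constructor <;> linarith [hy.1, hy.2]
      gcongr)
  rwa [Real.norm_eq_abs, abs_of_nonneg (sub_nonneg.2 hst)] at this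

/-- Two nonlocal operators with horizons below `h` differ by `O(h²)`. -/
theorem abs_nonlocalOp_sub_le_sq {u : ℝ → ℝ} {s : Set ℝ} {x M δ δ' h : ℝ}
    (hT : HasCubicApprox u s M) (hu : ContinuousOn u s) (hM : 0 ≤ M) (hx : x ∈ s)
    (hδ : 0 < δ) (hδ' : 0 < δ') (hh : δ ≤ h) (hh' : δ' ≤ h)
    (hs : Set.Icc (x - δ) (x + δ) ⊆ s) (hs' : Set.Icc (x - δ') (x + δ') ⊆ s) :
    |nonlocalOp δ u x - nonlocalOp δ' u x| ≤ 12 * M * h ^ 2 := by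
  obtain ⟨b, c, d, hp⟩ := hT x hx
  have key : ∀ ε, 0 < ε → ε ≤ h → Set.Icc (x - ε) (x + ε) ⊆ s →
      |nonlocalOp ε u x - 2 * c| ≤ 6 * M * h ^ 2 := by
    intro ε hε hεh hεs
    rw [nonlocalOp_eq_add_remainder (b := b) (c := c) (d := d) hε (hu.mono hεs),
      add_sub_cancel_left, abs_mul, abs_of_nonneg (by positivity)]
    have := abs_integral_le_of_quartic (x := x) (s := x - ε) (t := x + ε) (ρ := ε) (by linarith)
      hM le_rfl le_rfl (fun y hy => hp y (hεs hy))
    calc _ ≤ 3 / ε ^ 3 * (M * ε ^ 4 * (x + ε - (x - ε))) := by gcongr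
      _ = 6 * M * ε ^ 2 := by field_simp; ring
      _ ≤ _ := by gcongr
  have h1 := abs_le.1 (key δ hδ hh hs)
  have h2 := abs_le.1 (key δ' hδ' hh' hs')
  rw [abs_le]
  constructor <;> linarith

/-- Two nonlocal operators whose horizons differ by at most `h` differ by `O(h δ)`. -/
theorem abs_nonlocalOp_sub_le_mul {u : ℝ → ℝ} {s : Set ℝ} {x M δ δ' h : ℝ}
    (hT : HasCubicApprox u s M) (hu : ContinuousOn u s) (hM : 0 ≤ M) (hx : x ∈ s)
    (hδ' : 0 < δ') (hle : δ' ≤ δ) (hh : δ ≤ δ' + h) (hs : Set.Icc (x - δ) (x + δ) ⊆ s) :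
    |nonlocalOp δ u x - nonlocalOp δ' u x| ≤ 24 * M * (h * δ) := by
  obtain ⟨b, c, d, hp⟩ := hT x hx
  have hδ : 0 < δ := hδ'.trans_le hle
  have hs' : Set.Icc (x - δ') (x + δ') ⊆ s :=
    (Set.Icc_subset_Icc (by linarith) (by linarith)).trans hs
  rw [nonlocalOp_eq_add_remainder (b := b) (c := c) (d := d) hδ (hu.mono hs),
    nonlocalOp_eq_add_remainder (b := b) (c := c) (d := d) hδ' (hu.mono hs')]
  set R : ℝ → ℝ := fun y => u y - (u x + b * (y - x) + c * (y - x) ^ 2 + d * (y - x) ^ 3) with hR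
  have hRc : ContinuousOn R s := hu.sub (Continuous.continuousOn (by fun_prop))
  have hi : ∀ p q, p ≤ q → x - δ ≤ p → q ≤ x + δ → IntervalIntegrable R volume p q := by
    intro p q hpq h1 h2
    refine (hRc.mono ?_).intervalIntegrable
    rw [Set.uIcc_of_le hpq]
    exact (Set.Icc_subset_Icc h1 h2).trans hs
  have hb : ∀ p q ρ, p ≤ q → x - ρ ≤ p → q ≤ x + ρ → ρ ≤ δ →
      |∫ y in p..q, R y| ≤ M * ρ ^ 4 * (q - p) := by
    intro p q ρ hpq h1 h2 h3
    refine abs_integral_le_of_quartic hpq hM h1 h2 (fun y hy => hp y (hs ?_))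
    exact ⟨by linarith [hy.1], by linarith [hy.2]⟩
  have hsplit : (∫ y in (x - δ)..(x + δ), R y) = (∫ y in (x - δ)..(x - δ'), R y) +
      (∫ y in (x - δ')..(x + δ'), R y) + ∫ y in (x + δ')..(x + δ), R y := by
    rw [integral_add_adjacent_intervals (hi _ _ (by linarith) (by linarith) (by linarith))
      (hi _ _ (by linarith) (by linarith) (by linarith)),
      integral_add_adjacent_intervals (hi _ _ (by linarith) (by linarith) (by linarith))
      (hi _ _ (by linarith) (by linarith) (by linarith))]
  have h1 := hb (x - δ) (x - δ') δ (by linarith) le_rfl (by linarith) le_rfl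
  have h2 := hb (x - δ') (x + δ') δ' (by linarith) le_rfl le_rfl hle
  have h3 := hb (x + δ') (x + δ) δ (by linarith) (by linarith) le_rfl le_rfl
  rw [hsplit]
  generalize (∫ y in (x - δ)..(x - δ'), R y) = I₁ at *
  generalize (∫ y in (x - δ')..(x + δ'), R y) = I₂ at *
  generalize (∫ y in (x + δ')..(x + δ), R y) = I₃ at *
  -- The `2c` cancels. What remains is the two outer shells, each of length at most `h`, and the
  -- change of kernel on the inner interval; these give the 6 and the 18 of the final 24.
  have e : 2 * c + 3 / δ ^ 3 * (I₁ + I₂ + I₃) - (2 * c + 3 / δ' ^ 3 * I₂) =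
      3 / δ ^ 3 * (I₁ + I₃) + -((3 / δ' ^ 3 - 3 / δ ^ 3) * I₂) := by ring
  rw [e]
  refine (abs_add_le _ _).trans ?_
  have hcoef : 0 ≤ 3 / δ' ^ 3 - 3 / δ ^ 3 := by
    rw [sub_nonneg]; gcongr
  have hlt : δ - δ' ≤ h := by linarith
  have hh0 : 0 ≤ h := by linarith
  have b1 : |3 / δ ^ 3 * (I₁ + I₃)| ≤ 6 * M * (h * δ) := by
    rw [abs_mul, abs_of_nonneg (by positivity)]
    calc _ ≤ 3 / δ ^ 3 * (M * δ ^ 4 * h + M * δ ^ 4 * h) := by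
          gcongr
          refine (abs_add_le _ _).trans (add_le_add (h1.trans ?_) (h3.trans ?_)) <;>
            gcongr <;> linarith
      _ = _ := by field_simp; ring
  have b2 : |-((3 / δ' ^ 3 - 3 / δ ^ 3) * I₂)| ≤ 18 * M * (h * δ) := by
    rw [abs_neg, abs_mul, abs_of_nonneg hcoef]
    calc _ ≤ (3 / δ' ^ 3 - 3 / δ ^ 3) * (M * δ' ^ 4 * (x + δ' - (x - δ'))) := by gcongr
      -- Factoring `δ³ - δ'³` exposes `δ - δ' ≤ h`.
      _ = 6 * M * (δ' ^ 2 * ((δ - δ') * (δ ^ 2 + δ * δ' + δ' ^ 2)) / δ ^ 3) := by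
          field_simp; ring
      _ ≤ 6 * M * (δ ^ 2 * (h * (δ ^ 2 + δ * δ + δ ^ 2)) / δ ^ 3) := by gcongr
      _ = _ := by field_simp; ring
  linarith

/-! ### Powers of `h` and the final estimate -/

/-- Both `δ ≥ h` and `δ ≥ c₁ h^β` bound the left side, by `h²` and `h^(4-2β)/c₁²`; the larger
exponent is therefore available. -/
theorem grid_error_rpow_le {h δ β c₁ : ℝ} (hh : 0 < h) (hle : h ≤ δ)
    (hc₁ : 0 < c₁) (hlow : c₁ * h ^ β ≤ δ) :
    h ^ 4 / δ ^ 2 ≤ (1 + 1 / c₁ ^ 2) * h ^ max (2 : ℝ) (4 - 2 * β) := by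
  have hδ : 0 < δ := hh.trans_le hle
  rcases le_total (4 - 2 * β) 2 with hβ | hβ
  · rw [max_eq_left hβ, Real.rpow_two]
    calc h ^ 4 / δ ^ 2 ≤ h ^ 4 / h ^ 2 := by gcongr
      _ = 1 * h ^ 2 := by field_simp
      _ ≤ _ := by gcongr; linarith [show 0 ≤ 1 / c₁ ^ 2 by positivity]
  · rw [max_eq_right hβ]
    have hp : 0 < h ^ β := Real.rpow_pos_of_pos hh β
    have e : h ^ (4 - 2 * β) = h ^ 4 / (h ^ β) ^ 2 := by
      rw [Real.rpow_sub hh, mul_comm 2 β, Real.rpow_mul hh.le, Real.rpow_two]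
      norm_cast
    rw [e]
    calc h ^ 4 / δ ^ 2 ≤ h ^ 4 / (c₁ * h ^ β) ^ 2 := by gcongr
      _ = 1 / c₁ ^ 2 * (h ^ 4 / (h ^ β) ^ 2) := by field_simp
      _ ≤ _ := by gcongr; linarith

end NonlocalCollocation

theorem theorem3p13 (β c₁ c₂ M : ℝ) (hβ : 0 ≤ β) (hc₁ : 0 < c₁) :
    ∃ C : ℝ, ∀ (N : ℕ) (δ : ℝ) (u : ℝ → ℝ),
      0 < δ →
      δ ≤ c₂ * NonlocalCollocation.meshSize N ^ β →
      ContDiffOn ℝ 4 u (NonlocalCollocation.enlargedDomain N δ) →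
      (∀ x ∈ NonlocalCollocation.enlargedDomain N δ,
        |iteratedDerivWithin 4 u (NonlocalCollocation.enlargedDomain N δ) x| ≤ M) →
      ∀ i : ℕ, 1 ≤ i → i ≤ 2 * N + 1 →
        (¬ NonlocalCollocation.IsGridPoint N δ →
          |NonlocalCollocation.nonlocalOp δ u (NonlocalCollocation.node N i) -
              NonlocalCollocation.shiftedSymmetricOp N δ u i| ≤
            C * NonlocalCollocation.meshSize N ^ min (2 : ℝ) (1 + β)) ∧
        (NonlocalCollocation.IsGridPoint N δ →
          c₁ * NonlocalCollocation.meshSize N ^ β ≤ δ →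
          |NonlocalCollocation.nonlocalOp δ u (NonlocalCollocation.node N i) -
              NonlocalCollocation.shiftedSymmetricOp N δ u i| ≤
            C * NonlocalCollocation.meshSize N ^ max (2 : ℝ) (4 - 2 * β)) := by
  -- Off the grid, 24 is 12 for quadrature plus 12 for the horizon change when `δ < h`, and `24
  -- |c₂|` covers that change when `δ ≥ h`. The last term serves grid points.
  refine ⟨|M| * (24 + 24 * |c₂| + 12 * (1 + 1 / c₁ ^ 2)), ?_⟩
  intro N δ u hδ hup hu hu4 i _ hi
  have hh := NonlocalCollocation.meshSize_pos N
  have hh1 := NonlocalCollocation.meshSize_le_one N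
  have hdh := NonlocalCollocation.meshSize_le_discreteHorizon (N := N) hδ
  have hx := NonlocalCollocation.node_mem_Icc hi
  have hlt : -max δ (NonlocalCollocation.discreteHorizon N δ) <
      1 + max δ (NonlocalCollocation.discreteHorizon N δ) := by
    linarith [le_max_left δ (NonlocalCollocation.discreteHorizon N δ)]
  have hT := NonlocalCollocation.hasCubicApprox_of_contDiffOn hlt hu hu4
  have huc := hu.continuousOn
  have hsub : ∀ ε, ε ≤ max δ (NonlocalCollocation.discreteHorizon N δ) →
      Set.Icc (NonlocalCollocation.node N i - ε) (NonlocalCollocation.node N i + ε) ⊆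
        NonlocalCollocation.enlargedDomain N δ := fun ε hε =>
    Set.Icc_subset_Icc (by linarith [hx.1]) (by linarith [hx.2])
  have hs := hsub δ (le_max_left _ _)
  have hs' := hsub _ (le_max_right _ _)
  have hxs : NonlocalCollocation.node N i ∈ NonlocalCollocation.enlargedDomain N δ :=
    hs ⟨by linarith, by linarith⟩
  have hM : 0 ≤ M := (abs_nonneg _).trans (hu4 _ hxs)
  rw [abs_of_nonneg hM]
  have hq := NonlocalCollocation.abs_nonlocalOp_discreteHorizon_sub_le hδ huc hT hM hs'
  set h := NonlocalCollocation.meshSize N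
  set d := NonlocalCollocation.discreteHorizon N δ
  have hd : 0 < d := hh.trans_le hdh
  have hc : 0 ≤ 1 / c₁ ^ 2 := by positivity
  constructor
  · intro _
    set p := h ^ min (2 : ℝ) (1 + β)
    have hp0 : 0 ≤ p := Real.rpow_nonneg hh.le _
    have hp2 : h ^ 2 ≤ p := by
      rw [← Real.rpow_two]
      exact Real.rpow_le_rpow_of_exponent_ge hh hh1 (min_le_left _ _)
    have hpβ : h * h ^ β ≤ p := by
      rw [← Real.rpow_one_add' hh.le (by linarith)]
      exact Real.rpow_le_rpow_of_exponent_ge hh hh1 (min_le_right _ _)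
    have hq2 : 12 * M * h ^ 4 / d ^ 2 ≤ M * (12 * p) := by
      calc 12 * M * h ^ 4 / d ^ 2 ≤ 12 * M * h ^ 4 / h ^ 2 := by gcongr
        _ = M * (12 * h ^ 2) := by field_simp
        _ ≤ _ := by gcongr
    have hdiff : |NonlocalCollocation.nonlocalOp δ u (NonlocalCollocation.node N i) -
        NonlocalCollocation.nonlocalOp d u (NonlocalCollocation.node N i)| ≤
        M * (12 * p + 24 * (|c₂| * p)) := by
      -- For `δ < h` the discrete horizon is `h` and exceeds `δ`, so the comparison that needs `δ̃ ≤
      -- δ` is unavailable.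
      rcases lt_or_ge δ h with hlt | hge
      · have hdeq : d = h := NonlocalCollocation.discreteHorizon_of_lt hδ hlt
        refine (NonlocalCollocation.abs_nonlocalOp_sub_le_sq hT huc hM hxs hδ hd hlt.le hdeq.le
          hs hs').trans ?_
        calc 12 * M * h ^ 2 = M * (12 * h ^ 2) := by ring
          _ ≤ M * (12 * p + 24 * (|c₂| * p)) := by
            gcongr
            have : 0 ≤ 24 * (|c₂| * p) := by positivity
            linarith
      · refine (NonlocalCollocation.abs_nonlocalOp_sub_le_mul hT huc hM hxs hd
          (NonlocalCollocation.discreteHorizon_le hge)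
          (NonlocalCollocation.lt_discreteHorizon_add hge).le hs).trans ?_
        have hδc : h * δ ≤ |c₂| * p := by
          calc h * δ ≤ h * (|c₂| * h ^ β) := by
                gcongr
                refine hup.trans ?_
                gcongr
                exact le_abs_self c₂
            _ = |c₂| * (h * h ^ β) := by ring
            _ ≤ _ := by gcongr
        calc 24 * M * (h * δ) = M * (24 * (h * δ)) := by ring
          _ ≤ M * (12 * p + 24 * (|c₂| * p)) := by
            gcongr
            linarith
    refine (abs_sub_le _ _ _).trans ((add_le_add hdiff (hq.trans hq2)).trans ?_)
    have : 0 ≤ M * (12 * (1 + 1 / c₁ ^ 2) * p) := by positivity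
    linarith
  · intro hg hlow
    have hdeq : d = δ := hg.discreteHorizon_eq hδ
    rw [hdeq] at hq
    set p := h ^ max (2 : ℝ) (4 - 2 * β)
    have hp0 : 0 ≤ p := Real.rpow_nonneg hh.le _
    have hgrid := NonlocalCollocation.grid_error_rpow_le hh (hg.meshSize_le hδ) hc₁ hlow
    refine hq.trans ?_
    calc 12 * M * h ^ 4 / δ ^ 2 = M * (12 * (h ^ 4 / δ ^ 2)) := by ring
      _ ≤ M * (12 * ((1 + 1 / c₁ ^ 2) * p)) := by gcongr
      _ ≤ M * (24 * p + 24 * |c₂| * p + 12 * ((1 + 1 / c₁ ^ 2) * p)) := by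
        gcongr
        have : 0 ≤ 24 * p + 24 * |c₂| * p := by positivity
        linarith
      _ = _ := by ring
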